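/- **Proposition 3.1.** Let $N=2^n$ and let $V_N=\{0,\dots,N-1\}^2\subset\mathbb Z^2$, with the $\ell_\infty$-distance $|u-v|=\max\{|u_1-v_1|,|u_2-v_2|\}$. For $j\ge 0$ let $\mathcal B_j$ be the set of boxes $B=(a+\{0,\dots,2^j-1\}^2)$, $a\in\mathbb Z^2$, and for $z\in\mathbb Z^2$ let $\mathcal B_j(z)$ be the set of $B\in\mathcal B_j$ that contain $z$. Let $\{b_{j,B}: j\ge 0,\ B\in\mathcal B_j\}$ be independent centered Gaussian variables with $\operatorname{Var}(b_{j,B})=2^{-2j}$. For an integer $k\ge1$ and $K=2^k$, the $K$-coarse modified branching random walk is $$\varphi_{N,z}=\sum_{j=0}^{\lfloor n/k\rfloor-1}\ \sum_{B\in\mathcal B_{jk}(z)}\sqrt k\, b_{jk,B},\qquad z\in V_N .$$ For $\gamma>0$ let $\mu_\gamma$ be the random probability measure on $V_N$ with $\mu_\gamma(v)=e^{\gamma\varphi_{N,v}}\big/\sum_{w\in V_N}e^{\gamma\varphi_{N,w}}$. Fix $0<\gamma<\sqrt{2\log 2}$. For every $\kappa>0$ there is $\rho=\rho(\gamma,\kappa)>0$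 such that for every integer $k\ge 1$, with $K=2^k$ held fixed, $$\mathbb P\Big(\mu_\gamma\times\mu_\gamma\big(\{(u,v):|u-v|<N^{1-\kappa}\}\big)>N^{-\rho}\Big)\longrightarrow 0\qquad\text{as } N=2^n\to\infty .$$ -/

import Mathlib

open MeasureTheory ProbabilityTheory Filter Topology

noncomputable section

namespace CoarseMBRW

/-- The `N × N` box of `ℤ²` whose left bottom corner is the origin. -/
def latticeBox (N : ℕ) : Finset (ℤ × ℤ) :=
  Finset.Ico (0 : ℤ) N ×ˢ Finset.Ico (0 : ℤ) N

/-- The `ℓ_∞`-distance on `ℤ²`. -/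
def linfDist (u v : ℤ × ℤ) : ℤ := max |u.1 - v.1| |u.2 - v.2|

/-- The box of side length `2 ^ j` (that is, with `2 ^ j * 2 ^ j` lattice points) with left bottom
corner `a`. The boxes of side length `2 ^ j` correspond bijectively to their corners `a`, by which
they are indexed below. -/
def box (j : ℕ) (a : ℤ × ℤ) : Finset (ℤ × ℤ) :=
  Finset.Ico a.1 (a.1 + 2 ^ j) ×ˢ Finset.Ico a.2 (a.2 + 2 ^ j)

/-- The (corners of the) boxes of side length `2 ^ j` that contain the vertex `z`. -/
def boxesContaining (j : ℕ) (z : ℤ × ℤ) : Finset (ℤ × ℤ) :=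
  Finset.Ioc (z.1 - 2 ^ j) z.1 ×ˢ Finset.Ioc (z.2 - 2 ^ j) z.2

theorem mem_boxesContaining (j : ℕ) (z a : ℤ × ℤ) :
    a ∈ boxesContaining j z ↔ z ∈ box j a := by
  simp only [boxesContaining, box, Finset.mem_product, Finset.mem_Ioc, Finset.mem_Ico]
  constructor <;> rintro ⟨⟨h1, h2⟩, h3, h4⟩ <;> refine ⟨⟨?_, ?_⟩, ?_, ?_⟩ <;> linarith

/-- `b` is a family of independent centered Gaussian variables, one for every `j ≥ 0` and every
box of side length `2 ^ j` (given by its corner), with variance `2 ^ (-2 j)`. -/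
structure IsBoxNoise {Ω : Type*} [MeasurableSpace Ω] (P : Measure Ω)
    (b : ℕ × (ℤ × ℤ) → Ω → ℝ) : Prop where
  measurable : ∀ i, Measurable (b i)
  law : ∀ i, P.map (b i) = gaussianReal 0 (((2 : NNReal) ^ (2 * i.1))⁻¹)
  indep : iIndepFun b P

/-- The `K`-coarse modified branching random walk with `K = 2 ^ k` and `N = 2 ^ n`, at `z`, as a
function of the values `x` of the variables attached to the boxes. -/
def coarseMBRW (k n : ℕ) (x : ℕ × (ℤ × ℤ) → ℝ) (z : ℤ × ℤ) : ℝ :=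
  ∑ j ∈ Finset.range (n / k), ∑ a ∈ boxesContaining (j * k) z, √(k : ℝ) * x (j * k, a)

/-- The discrete Liouville quantum gravity measure of a field `φ` on `V`: the measure on `V`
that gives `v` a mass proportional to `exp (γ φ v)`, with total mass `1`. -/
def lqgMeasure (γ : ℝ) (V : Finset (ℤ × ℤ)) (φ : ℤ × ℤ → ℝ) : Measure (ℤ × ℤ) :=
  ∑ v ∈ V, ENNReal.ofReal (Real.exp (γ * φ v) / ∑ w ∈ V, Real.exp (γ * φ w)) • Measure.dirac v

end CoarseMBRW

end

namespace CoarseMBRW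

variable {Ω : Type*} [MeasurableSpace Ω] {P : Measure Ω} {b : ℕ × (ℤ × ℤ) → Ω → ℝ}

/-! The condition `γ ^ 2 < 2 * log 2` is the second-moment regime. Let `L = n / k`, let `Z` be the
partition function and `S` the sum of `exp (γ φ_u) * exp (γ φ_v)` over close pairs; the mass in
question is `S / Z ^ 2`. Upper bound on `S`: a pair costs an extra factor `exp (γ ^ 2 * k)` for each
scale whose boxes can contain both points. Weighing this against the number of such pairs gives `E S
≤ 16 (L + 1) exp (-τ n) (E Z) ^ 2` with `τ = κ (2 log 2 - γ ^ 2)`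
(`sum_exp_pow_card_commonLevels_le`, `IsBoxNoise.exp_sum_pairs`), and Markov's inequality applies.
Lower bound on `Z`: the partition function `X` without the coarsest `√L` levels concentrates by
Chebyshev (`IsBoxNoise.partition_lower_tail`). If `Y` is the partition function with the signs of
those levels reversed, Cauchy–Schwarz gives `X ^ 2 ≤ Z * Y` (`sq_sum_exp_le`), and `Y` has the same
mean as `Z`. The missing levels cost only `exp (O(k √L)) = exp (o(n))`, so `ρ` does not depend on
`k`. -/

/-! ### Exponential moments of the field. -/

theorem card_boxesContaining (j : ℕ) (z : ℤ × ℤ) :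
    (boxesContaining j z).card = 2 ^ (2 * j) := by
  have h : ((2 : ℤ) ^ j).toNat = 2 ^ j := by
    rw [← Nat.cast_ofNat, ← Nat.cast_pow, Int.toNat_natCast]
  simp [boxesContaining, h]
  ring

theorem IsBoxNoise.mgf_mul (hb : IsBoxNoise P b) (i : ℕ × (ℤ × ℤ)) (c : ℝ) :
    mgf (fun ω => c * b i ω) P 1 = Real.exp (c ^ 2 / 2 * ((2 : ℝ) ^ (2 * i.1))⁻¹) ∧
      Integrable (fun ω => Real.exp (1 * (c * b i ω))) P := by
  constructor
  · rw [mgf_const_mul, mgf_gaussianReal (hb.law i)]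
    congr 1
    push_cast
    ring
  · have h := integrable_exp_mul_gaussianReal (μ := 0) (v := ((2 : NNReal) ^ (2 * i.1))⁻¹) c
    rw [← hb.law i] at h
    have h2 := h.comp_measurable (hb.measurable i)
    simpa [Function.comp_def] using h2

/-- The Laplace transform of a finite linear combination of the box variables. -/
theorem IsBoxNoise.exp_sum [IsProbabilityMeasure P] (hb : IsBoxNoise P b) {k : ℕ} (hk : 1 ≤ k)
    (M : ℕ) (T : Finset (ℤ × ℤ)) (c : ℕ → ℤ × ℤ → ℝ) :
    Integrable (fun ω => Real.exp (∑ j ∈ Finset.range M, ∑ a ∈ T, c j a * b (j * k, a) ω)) P ∧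
    ∫ ω, Real.exp (∑ j ∈ Finset.range M, ∑ a ∈ T, c j a * b (j * k, a) ω) ∂P =
      Real.exp (∑ j ∈ Finset.range M, ∑ a ∈ T,
        c j a ^ 2 / 2 * ((2 : ℝ) ^ (2 * (j * k)))⁻¹) := by
  set X : ℕ × (ℤ × ℤ) → Ω → ℝ := fun p ω => c p.1 p.2 * b (p.1 * k, p.2) ω with hX
  have hmeas : ∀ p, Measurable (X p) := fun p => (hb.measurable _).const_mul _
  -- Since `k ≥ 1`, distinct levels use distinct variables, so the subfamily is still independent.
  have hinj : Function.Injective (fun p : ℕ × (ℤ × ℤ) => (p.1 * k, p.2)) := by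
    rintro ⟨i, a⟩ ⟨j, a'⟩ h
    simp only [Prod.mk.injEq] at h ⊢
    exact ⟨Nat.eq_of_mul_eq_mul_right hk h.1, h.2⟩
  have hind : iIndepFun X P := by
    have h1 := hb.indep.precomp hinj
    exact h1.comp (fun p x => c p.1 p.2 * x) (fun p => measurable_const_mul _)
  have hsum : ∀ ω, ∑ j ∈ Finset.range M, ∑ a ∈ T, c j a * b (j * k, a) ω =
      ∑ p ∈ Finset.range M ×ˢ T, X p ω := fun ω => by rw [Finset.sum_product]
  have hi := hind.integrable_exp_mul_sum (t := 1) hmeas (s := Finset.range M ×ˢ T)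
    (fun p _ => (hb.mgf_mul _ _).2)
  have hm := hind.mgf_sum (t := 1) hmeas (Finset.range M ×ˢ T)
  simp only [hsum]
  constructor
  · simpa using hi
  · have : ∫ ω, Real.exp (∑ p ∈ Finset.range M ×ˢ T, X p ω) ∂P =
        mgf (∑ p ∈ Finset.range M ×ˢ T, X p) P 1 := by simp [mgf]
    rw [this, hm, Finset.prod_congr rfl (fun p _ => (hb.mgf_mul _ _).1), ← Real.exp_sum,
      Finset.sum_product]

/-- The coarse walk with `M` levels in which level `j` is multiplied by `c j`. -/
noncomputable def levelField (k M : ℕ) (c : ℕ → ℝ) (x : ℕ × (ℤ × ℤ) → ℝ) (z : ℤ × ℤ) : ℝ :=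
  ∑ j ∈ Finset.range M, ∑ a ∈ boxesContaining (j * k) z, c j * (√(k : ℝ) * x (j * k, a))

/-- The number of levels below `M` whose boxes can contain both `u` and `v`. -/
def commonLevels (k M : ℕ) (u v : ℤ × ℤ) : Finset ℕ :=
  {j ∈ Finset.range M | linfDist u v < 2 ^ (j * k)}

theorem card_boxesContaining_inter_le (i : ℕ) (u v : ℤ × ℤ) :
    ((boxesContaining i u ∩ boxesContaining i v).card : ℝ) * ((2 : ℝ) ^ (2 * i))⁻¹ ≤
      if linfDist u v < 2 ^ i then 1 else 0 := by
  split_ifs with h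
  · rw [← div_eq_mul_inv, div_le_one (by positivity)]
    have := Finset.card_le_card (Finset.inter_subset_left
      (s₁ := boxesContaining i u) (s₂ := boxesContaining i v))
    rw [card_boxesContaining] at this
    exact_mod_cast this
  · have : boxesContaining i u ∩ boxesContaining i v = ∅ := by
      by_contra hne
      obtain ⟨a, ha⟩ := Finset.nonempty_iff_ne_empty.mpr hne
      simp only [boxesContaining, Finset.mem_inter, Finset.mem_product, Finset.mem_Ioc] at ha
      apply h
      rw [linfDist, max_lt_iff, abs_lt, abs_lt]
      refine ⟨⟨?_, ?_⟩, ?_, ?_⟩ <;> linarith [ha.1.1.1, ha.1.1.2, ha.1.2.1, ha.1.2.2,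
        ha.2.1.1, ha.2.1.2, ha.2.2.1, ha.2.2.2]
    simp [this]

theorem IsBoxNoise.exp_levelField [IsProbabilityMeasure P] (hb : IsBoxNoise P b) {k : ℕ}
    (hk : 1 ≤ k) (M : ℕ) (c : ℕ → ℝ) (γ : ℝ) (z : ℤ × ℤ) :
    Integrable (fun ω => Real.exp (γ * levelField k M c (fun i => b i ω) z)) P ∧
    ∫ ω, Real.exp (γ * levelField k M c (fun i => b i ω) z) ∂P =
      Real.exp (γ ^ 2 * k / 2 * ∑ j ∈ Finset.range M, c j ^ 2) := by
  classical
  set T : Finset (ℤ × ℤ) := (Finset.range M).biUnion fun j => boxesContaining (j * k) z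
  have hT : ∀ j ∈ Finset.range M, T ∩ boxesContaining (j * k) z = boxesContaining (j * k) z :=
    fun j hj => Finset.inter_eq_right.mpr
      (Finset.subset_biUnion_of_mem (fun j => boxesContaining (j * k) z) hj)
  have h := hb.exp_sum hk M T
    (fun j a => if a ∈ boxesContaining (j * k) z then γ * c j * √(k : ℝ) else 0)
  have h1 : ∀ ω, γ * levelField k M c (fun i => b i ω) z =
      ∑ j ∈ Finset.range M, ∑ a ∈ T,
        (if a ∈ boxesContaining (j * k) z then γ * c j * √(k : ℝ) else 0) * b (j * k, a) ω := by
    intro ω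
    rw [levelField, Finset.mul_sum]
    refine Finset.sum_congr rfl fun j hj => ?_
    simp only [ite_mul, zero_mul, Finset.sum_ite_mem, hT j hj, Finset.mul_sum]
    exact Finset.sum_congr rfl fun a _ => by ring
  simp only [h1]
  refine ⟨h.1, h.2.trans ?_⟩
  rw [Finset.mul_sum]
  congr 1
  refine Finset.sum_congr rfl fun j hj => ?_
  have h2 : ∀ a : ℤ × ℤ, (if a ∈ boxesContaining (j * k) z then γ * c j * √(k : ℝ) else 0) ^ 2 / 2
      * ((2 : ℝ) ^ (2 * (j * k)))⁻¹ = if a ∈ boxesContaining (j * k) z then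
        γ ^ 2 * c j ^ 2 * k / 2 * ((2 : ℝ) ^ (2 * (j * k)))⁻¹ else 0 := by
    intro a
    split_ifs
    · rw [mul_pow, mul_pow, Real.sq_sqrt (Nat.cast_nonneg k)]
    · simp
  simp only [h2, Finset.sum_ite_mem, hT j hj, Finset.sum_const, card_boxesContaining, nsmul_eq_mul]
  push_cast
  field_simp

/-- A shared box enters with coefficient 2, and `(1_u + 1_v) ^ 2 = 1_u + 1_v + 2 * 1_{u,v}`, so the
covariance at each level is at most `k`, and vanishes unless the level is common. -/
theorem IsBoxNoise.exp_pair [IsProbabilityMeasure P] (hb : IsBoxNoise P b) {k : ℕ}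
    (hk : 1 ≤ k) (M : ℕ) (γ : ℝ) (u v : ℤ × ℤ) :
    Integrable (fun ω => Real.exp (γ * levelField k M 1 (fun i => b i ω) u) *
      Real.exp (γ * levelField k M 1 (fun i => b i ω) v)) P ∧
    ∫ ω, Real.exp (γ * levelField k M 1 (fun i => b i ω) u) *
      Real.exp (γ * levelField k M 1 (fun i => b i ω) v) ∂P ≤
      Real.exp (γ ^ 2 * k * M) * Real.exp (γ ^ 2 * k) ^ (commonLevels k M u v).card := by
  classical
  set T : Finset (ℤ × ℤ) := (Finset.range M).biUnion fun j =>
    boxesContaining (j * k) u ∪ boxesContaining (j * k) v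
  have hTu : ∀ j ∈ Finset.range M, T ∩ boxesContaining (j * k) u = boxesContaining (j * k) u :=
    fun j hj => Finset.inter_eq_right.mpr (Finset.subset_union_left.trans
      (Finset.subset_biUnion_of_mem
        (fun j => boxesContaining (j * k) u ∪ boxesContaining (j * k) v) hj))
  have hTv : ∀ j ∈ Finset.range M, T ∩ boxesContaining (j * k) v = boxesContaining (j * k) v :=
    fun j hj => Finset.inter_eq_right.mpr (Finset.subset_union_right.trans
      (Finset.subset_biUnion_of_mem
        (fun j => boxesContaining (j * k) u ∪ boxesContaining (j * k) v) hj))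
  have hTuv : ∀ j ∈ Finset.range M, T ∩ (boxesContaining (j * k) u ∩ boxesContaining (j * k) v) =
      boxesContaining (j * k) u ∩ boxesContaining (j * k) v :=
    fun j hj => by rw [← Finset.inter_assoc, hTu j hj]
  have h := hb.exp_sum hk M T
    (fun j a => γ * √(k : ℝ) * ((if a ∈ boxesContaining (j * k) u then 1 else 0) +
      (if a ∈ boxesContaining (j * k) v then 1 else 0)))
  have h1 : ∀ ω, Real.exp (γ * levelField k M 1 (fun i => b i ω) u) *
      Real.exp (γ * levelField k M 1 (fun i => b i ω) v) = Real.exp (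
      ∑ j ∈ Finset.range M, ∑ a ∈ T,
        (γ * √(k : ℝ) * ((if a ∈ boxesContaining (j * k) u then 1 else 0) +
      (if a ∈ boxesContaining (j * k) v then 1 else 0))) * b (j * k, a) ω) := by
    intro ω
    rw [← Real.exp_add, levelField, levelField, Finset.mul_sum, Finset.mul_sum,
      ← Finset.sum_add_distrib]
    congr 1
    refine Finset.sum_congr rfl fun j hj => ?_
    simp only [mul_add, add_mul, mul_ite, ite_mul, mul_one, mul_zero, zero_mul,
      Finset.sum_add_distrib, Finset.sum_ite_mem, hTu j hj, hTv j hj, Finset.mul_sum]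
    simp [mul_assoc]
  simp only [h1]
  refine ⟨h.1, h.2.le.trans ?_⟩
  rw [← Real.exp_nat_mul, ← Real.exp_add, Real.exp_le_exp]
  have hc : γ ^ 2 * k * M + (commonLevels k M u v).card * (γ ^ 2 * k) =
      ∑ j ∈ Finset.range M, (γ ^ 2 * k + γ ^ 2 * k *
        if linfDist u v < 2 ^ (j * k) then 1 else 0) := by
    rw [commonLevels, Finset.sum_add_distrib, ← Finset.mul_sum (f := fun j : ℕ =>
      if linfDist u v < 2 ^ (j * k) then (1 : ℝ) else 0), Finset.sum_boole, Finset.sum_const,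
      Finset.card_range, nsmul_eq_mul]
    ring
  rw [hc]
  refine Finset.sum_le_sum fun j hj => ?_
  have h2 : ∀ a : ℤ × ℤ, (γ * √(k : ℝ) * ((if a ∈ boxesContaining (j * k) u then 1 else 0) +
      (if a ∈ boxesContaining (j * k) v then 1 else 0))) ^ 2 / 2
      * ((2 : ℝ) ^ (2 * (j * k)))⁻¹ = γ ^ 2 * k / 2 * ((2 : ℝ) ^ (2 * (j * k)))⁻¹ *
      ((if a ∈ boxesContaining (j * k) u then 1 else 0) +
      (if a ∈ boxesContaining (j * k) v then 1 else 0) + 2 *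
      (if a ∈ boxesContaining (j * k) u ∩ boxesContaining (j * k) v then 1 else 0)) := by
    intro a
    rw [mul_pow, mul_pow, Real.sq_sqrt (Nat.cast_nonneg k)]
    by_cases hu : a ∈ boxesContaining (j * k) u <;> by_cases hv : a ∈ boxesContaining (j * k) v <;>
      simp [hu, hv]
    ring
  simp only [h2]
  rw [← Finset.mul_sum, Finset.sum_add_distrib, Finset.sum_add_distrib, ← Finset.mul_sum,
    Finset.sum_ite_mem, Finset.sum_ite_mem, Finset.sum_ite_mem, hTu j hj, hTv j hj, hTuv j hj]
  have h3 := card_boxesContaining_inter_le (j * k) u v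
  simp only [Finset.sum_const, card_boxesContaining, nsmul_eq_mul, mul_one]
  have h4 : γ ^ 2 * k / 2 * ((2 : ℝ) ^ (2 * (j * k)))⁻¹ * (((2 ^ (2 * (j * k)) : ℕ) : ℝ) +
      ((2 ^ (2 * (j * k)) : ℕ) : ℝ) +
      2 * ((boxesContaining (j * k) u ∩ boxesContaining (j * k) v).card : ℝ)) =
      γ ^ 2 * k + γ ^ 2 * k * (((boxesContaining (j * k) u ∩ boxesContaining (j * k) v).card : ℝ)
        * ((2 : ℝ) ^ (2 * (j * k)))⁻¹) := by
    push_cast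
    field_simp
    ring
  rw [h4]
  gcongr

/-! ### Counting pairs by the scales they share. -/

theorem card_le_of_linfDist_lt (W : Finset (ℤ × ℤ)) (u : ℤ × ℤ) {X : ℝ} (hX : 1 ≤ X)
    (hW : ∀ v ∈ W, (linfDist u v : ℝ) < X) : (W.card : ℝ) ≤ 16 * X ^ 2 := by
  set D : ℕ := ⌈X⌉₊
  have hD : X ≤ D := Nat.le_ceil X
  have hD2 : (D : ℝ) ≤ 2 * X := by linarith [Nat.ceil_lt_add_one (by linarith : 0 ≤ X)]
  have hsub : W ⊆ Finset.Ico (u.1 - D) (u.1 + D) ×ˢ Finset.Ico (u.2 - D) (u.2 + D) := by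
    intro v hv
    have h : linfDist u v < D := by exact_mod_cast (hW v hv).trans_le hD
    rw [linfDist, max_lt_iff, abs_lt, abs_lt] at h
    simp only [Finset.mem_product, Finset.mem_Ico]
    omega
  have hcard := Finset.card_le_card hsub
  have h2 : ∀ x : ℤ, (x + D - (x - D)).toNat = 2 * D := fun x => by omega
  rw [Finset.card_product, Int.card_Ico, Int.card_Ico, h2, h2] at hcard
  have h3 : (W.card : ℝ) ≤ 2 * D * (2 * D) := by exact_mod_cast hcard
  nlinarith

/-- If `j` is the least common level, all common levels lie in `[j, M)`, and the `j`-th summand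
alone suffices; the 1 covers the case of no common level. -/
theorem pow_card_commonLevels_le {q : ℝ} (hq : 1 ≤ q) (k M : ℕ) (u v : ℤ × ℤ) :
    q ^ (commonLevels k M u v).card ≤
      1 + ∑ j ∈ Finset.range M, if linfDist u v < 2 ^ (j * k) then q ^ (M - j) else 0 := by
  have hnn : ∀ j ∈ Finset.range M,
      0 ≤ if linfDist u v < 2 ^ (j * k) then q ^ (M - j) else 0 := by
    intro j _
    split_ifs <;> positivity
  rcases (commonLevels k M u v).eq_empty_or_nonempty with h | h
  · rw [h]
    simpa using Finset.sum_nonneg hnn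
  · set j := (commonLevels k M u v).min' h
    have hj : j ∈ commonLevels k M u v := Finset.min'_mem _ h
    have hcard : (commonLevels k M u v).card ≤ M - j := by
      rw [← Nat.card_Ico]
      refine Finset.card_le_card fun i hi => Finset.mem_Ico.mpr ⟨Finset.min'_le _ _ hi, ?_⟩
      exact Finset.mem_range.mp (Finset.mem_filter.mp hi).1
    obtain ⟨hjM, hjd⟩ := Finset.mem_filter.mp hj
    have h1 := Finset.single_le_sum hnn hjM
    rw [if_pos hjd] at h1
    linarith [pow_le_pow_right₀ hq hcard]

theorem sum_pow_card_commonLevels_le {q : ℝ} (hq : 1 ≤ q) (k M : ℕ) (W : Finset (ℤ × ℤ))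
    (u : ℤ × ℤ) :
    ∑ v ∈ W, q ^ (commonLevels k M u v).card ≤ W.card + ∑ j ∈ Finset.range M,
      q ^ (M - j) * ((W.filter fun v => linfDist u v < 2 ^ (j * k)).card : ℝ) := by
  refine (Finset.sum_le_sum fun v _ => pow_card_commonLevels_le hq k M u v).trans_eq ?_
  rw [Finset.sum_add_distrib, Finset.sum_comm]
  congr 1
  · simp
  · refine Finset.sum_congr rfl fun j _ => ?_
    rw [← Finset.sum_filter, Finset.sum_const, nsmul_eq_mul, mul_comm]

theorem card_filter_linfDist_lt_two_pow_le (W : Finset (ℤ × ℤ)) (u : ℤ × ℤ) (i : ℕ) :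
    ((W.filter fun v => linfDist u v < 2 ^ i).card : ℝ) ≤ 16 * ((2 : ℝ) ^ i) ^ 2 := by
  refine card_le_of_linfDist_lt _ u (one_le_pow₀ one_le_two) fun v hv => ?_
  exact_mod_cast (Finset.mem_filter.mp hv).2

theorem sum_pow_card_commonLevels_le_card_add {q : ℝ} (hq : 1 ≤ q) {k : ℕ} (hqk : q ≤ 4 ^ k)
    (M : ℕ) (W : Finset (ℤ × ℤ)) (u : ℤ × ℤ) :
    ∑ v ∈ W, q ^ (commonLevels k M u v).card ≤ W.card + 16 * M * 4 ^ (k * M) := by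
  refine (sum_pow_card_commonLevels_le hq k M W u).trans (add_le_add le_rfl ?_)
  have h : ∀ j ∈ Finset.range M, q ^ (M - j) *
      ((W.filter fun v => linfDist u v < 2 ^ (j * k)).card : ℝ) ≤ 16 * 4 ^ (k * M) := by
    intro j hj
    have hjM := Finset.mem_range.mp hj
    calc _ ≤ ((4 : ℝ) ^ k) ^ (M - j) * (16 * ((2 : ℝ) ^ (j * k)) ^ 2) := by
          gcongr
          exact card_filter_linfDist_lt_two_pow_le W u _
      _ = 16 * (((4 : ℝ) ^ k) ^ (M - j) * ((4 : ℝ) ^ k) ^ j) := by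
          have h4 : ((2 : ℝ) ^ (j * k)) ^ 2 = ((4 : ℝ) ^ k) ^ j := by
            rw [← pow_mul, ← pow_mul, show j * k * 2 = 2 * (k * j) by ring, pow_mul]
            norm_num
          rw [h4]
          ring
      _ = 16 * 4 ^ (k * M) := by rw [← pow_add, Nat.sub_add_cancel hjM.le, ← pow_mul]
  refine (Finset.sum_le_sum h).trans_eq ?_
  rw [Finset.sum_const, Finset.card_range, nsmul_eq_mul]
  ring

/-- The points within `2 ^ (j * k)` of `u` number at most 16 times the smaller of `exp (2 r)` and `4
^ (j * k)`, hence of their geometric mean with weights `1 - s` and `s`. For this `s` the second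
factor is `exp (γ ^ 2 * k * j)`, which cancels the dependence on `j` of the pair weight. -/
theorem sum_exp_pow_card_commonLevels_le {γ : ℝ} {s : ℝ} (hs0 : 0 ≤ s) (hs1 : s ≤ 1)
    (hs : γ ^ 2 = s * (2 * Real.log 2)) {k M n : ℕ} (hn : k * M ≤ n) {r : ℝ} (hr0 : 0 ≤ r)
    (hr : r ≤ n * Real.log 2) (W : Finset (ℤ × ℤ)) (u : ℤ × ℤ)
    (hW : ∀ v ∈ W, (linfDist u v : ℝ) < Real.exp r) :
    ∑ v ∈ W, Real.exp (γ ^ 2 * k) ^ (commonLevels k M u v).card ≤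
      16 * (M + 1) * Real.exp (2 * (1 - s) * r + γ ^ 2 * n) := by
  have hl : 0 < Real.log 2 := Real.log_pos one_lt_two
  have hX : 1 ≤ Real.exp r := Real.one_le_exp hr0
  have hexp : ∀ x : ℝ, Real.exp x ^ 2 = Real.exp (2 * x) := fun x => by
    rw [← Real.exp_nat_mul]
    norm_num
  refine (sum_pow_card_commonLevels_le (Real.one_le_exp (by positivity)) k M W u).trans ?_
  have h0 : (W.card : ℝ) ≤ 16 * Real.exp (2 * (1 - s) * r + γ ^ 2 * n) := by
    refine (card_le_of_linfDist_lt W u hX hW).trans ?_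
    rw [hexp]
    gcongr
    rw [hs]
    nlinarith [mul_le_mul_of_nonneg_left hr hs0]
  have h : ∀ j ∈ Finset.range M, Real.exp (γ ^ 2 * k) ^ (M - j) *
      ((W.filter fun v => linfDist u v < 2 ^ (j * k)).card : ℝ) ≤
      16 * Real.exp (2 * (1 - s) * r + γ ^ 2 * n) := by
    intro j hj
    have hjM := Finset.mem_range.mp hj
    have hc1 : ((W.filter fun v => linfDist u v < 2 ^ (j * k)).card : ℝ) ≤
        16 * Real.exp (2 * r) := by
      rw [← hexp]
      exact card_le_of_linfDist_lt _ u hX fun v hv => hW v (Finset.mem_filter.mp hv).1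
    have hc2 : ((W.filter fun v => linfDist u v < 2 ^ (j * k)).card : ℝ) ≤
        16 * Real.exp (2 * (j * k * Real.log 2)) := by
      refine (card_filter_linfDist_lt_two_pow_le W u _).trans_eq ?_
      rw [← hexp, ← Nat.cast_mul, Real.exp_nat_mul, Real.exp_log two_pos]
    have hc : ((W.filter fun v => linfDist u v < 2 ^ (j * k)).card : ℝ) ≤
        16 * Real.exp ((1 - s) * (2 * r) + s * (2 * (j * k * Real.log 2))) := by
      rcases le_total (2 * r) (2 * (j * k * Real.log 2)) with h | h
      · refine hc1.trans ?_
        gcongr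
        nlinarith
      · refine hc2.trans ?_
        gcongr
        nlinarith
    refine (mul_le_mul_of_nonneg_left hc (by positivity)).trans ?_
    rw [mul_left_comm, ← Real.exp_nat_mul, ← Real.exp_add, Nat.cast_sub hjM.le]
    refine mul_le_mul_of_nonneg_left (Real.exp_le_exp.mpr ?_) (by norm_num)
    have hn' : (k : ℝ) * M ≤ n := by exact_mod_cast hn
    have := mul_le_mul_of_nonneg_left hn' (sq_nonneg γ)
    have h2 : s * (2 * (j * k * Real.log 2)) = γ ^ 2 * k * j := by rw [hs]; ring
    rw [h2]
    linarith
  refine (add_le_add h0 (Finset.sum_le_sum h)).trans_eq ?_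
  rw [Finset.sum_const, Finset.card_range, nsmul_eq_mul]
  ring

/-! ### Tail bounds from first and second moments. -/

theorem measureReal_exp_mul_lt_le [IsProbabilityMeasure P] {f : Ω → ℝ} (hf : 0 ≤ f)
    (hi : Integrable f P) {C : ℝ} (hC0 : 0 < C) (hC : ∫ ω, f ω ∂P ≤ C) (t : ℝ) :
    P.real {ω | Real.exp t * C < f ω} ≤ Real.exp (-t) := by
  have h := mul_meas_ge_le_integral_of_nonneg (Eventually.of_forall hf) hi (Real.exp t * C)
  have h1 : P.real {ω | Real.exp t * C < f ω} ≤ P.real {ω | Real.exp t * C ≤ f ω} :=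
    measureReal_mono fun ω (hω : Real.exp t * C < f ω) => hω.le
  have h2 : P.real {ω | Real.exp t * C ≤ f ω} * Real.exp t * C ≤ 1 * C := by linarith
  rw [Real.exp_neg, ← one_div, le_div_iff₀ (Real.exp_pos t)]
  exact (mul_le_mul_of_nonneg_right h1 (Real.exp_nonneg t)).trans (le_of_mul_le_mul_right h2 hC0)

theorem IsBoxNoise.exp_sum_pairs [IsProbabilityMeasure P] (hb : IsBoxNoise P b) {k : ℕ}
    (hk : 1 ≤ k) (M : ℕ) (γ : ℝ) (V : Finset (ℤ × ℤ)) (W : ℤ × ℤ → Finset (ℤ × ℤ)) {C : ℝ}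
    (hC : ∀ u ∈ V, ∑ v ∈ W u, Real.exp (γ ^ 2 * k) ^ (commonLevels k M u v).card ≤ C) :
    Integrable (fun ω => ∑ u ∈ V, ∑ v ∈ W u,
      Real.exp (γ * levelField k M 1 (fun i => b i ω) u) *
      Real.exp (γ * levelField k M 1 (fun i => b i ω) v)) P ∧
    ∫ ω, ∑ u ∈ V, ∑ v ∈ W u, Real.exp (γ * levelField k M 1 (fun i => b i ω) u) *
      Real.exp (γ * levelField k M 1 (fun i => b i ω) v) ∂P ≤
      Real.exp (γ ^ 2 * k * M) * (V.card * C) := by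
  have hi := fun u v => (hb.exp_pair hk M γ u v).1
  have hi2 := fun u => integrable_finsetSum (W u) fun v _ => hi u v
  refine ⟨integrable_finsetSum _ fun u _ => hi2 u, ?_⟩
  rw [integral_finsetSum _ fun u _ => hi2 u, ← nsmul_eq_mul, ← Finset.sum_const, Finset.mul_sum]
  refine Finset.sum_le_sum fun u hu => ?_
  rw [integral_finsetSum _ fun v _ => hi u v]
  refine (Finset.sum_le_sum fun v _ => (hb.exp_pair hk M γ u v).2).trans ?_
  rw [← Finset.mul_sum]
  exact mul_le_mul_of_nonneg_left (hC u hu) (Real.exp_nonneg _)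

theorem IsBoxNoise.exp_sum_levelField [IsProbabilityMeasure P] (hb : IsBoxNoise P b) {k : ℕ}
    (hk : 1 ≤ k) (M : ℕ) (c : ℕ → ℝ) (hc : ∀ j, c j ^ 2 = 1) (γ : ℝ) (V : Finset (ℤ × ℤ)) :
    Integrable (fun ω => ∑ z ∈ V, Real.exp (γ * levelField k M c (fun i => b i ω) z)) P ∧
    ∫ ω, ∑ z ∈ V, Real.exp (γ * levelField k M c (fun i => b i ω) z) ∂P =
      V.card * Real.exp (γ ^ 2 * k * M / 2) := by
  have h := hb.exp_levelField hk M c γ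
  refine ⟨integrable_finsetSum _ fun z _ => (h z).1, ?_⟩
  rw [integral_finsetSum _ fun z _ => (h z).1]
  simp only [h, hc, Finset.sum_const, Finset.card_range, nsmul_eq_mul, mul_one]
  ring_nf

/-- Chebyshev's inequality for the partition function. -/
theorem IsBoxNoise.partition_lower_tail [IsProbabilityMeasure P] (hb : IsBoxNoise P b) {k : ℕ}
    (hk : 1 ≤ k) (M : ℕ) {γ : ℝ} (hγ : γ ^ 2 ≤ 2 * Real.log 2) {V : Finset (ℤ × ℤ)}
    (hV : V.Nonempty) :
    P.real {ω | ∑ z ∈ V, Real.exp (γ * levelField k M 1 (fun i => b i ω) z) <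
      V.card * Real.exp (γ ^ 2 * k * M / 2) / 2} ≤ 64 * M * 4 ^ (k * M) / V.card := by
  set Z : Ω → ℝ := fun ω => ∑ z ∈ V, Real.exp (γ * levelField k M 1 (fun i => b i ω) z) with hZ
  set m : ℝ := V.card * Real.exp (γ ^ 2 * k * M / 2) with hm
  have hV0 : (0 : ℝ) < V.card := by exact_mod_cast hV.card_pos
  have hm0 : 0 < m := by positivity
  have hm2 : Real.exp (γ ^ 2 * k * M) * V.card ^ 2 = m ^ 2 := by
    rw [hm, mul_pow, ← Real.exp_nat_mul, mul_comm]
    congr 2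
    push_cast
    ring
  have hq : Real.exp (γ ^ 2 * k) ≤ 4 ^ k := by
    have h4 : (4 : ℝ) = Real.exp (2 * Real.log 2) := by
      rw [two_mul, Real.exp_add, Real.exp_log two_pos]
      norm_num
    rw [h4, ← Real.exp_nat_mul, mul_comm]
    gcongr
  obtain ⟨hZi, hZm⟩ := hb.exp_sum_levelField hk M 1 (by simp) γ V
  obtain ⟨h2i, h2m⟩ := hb.exp_sum_pairs hk M γ V (fun _ => V) fun u _ =>
    sum_pow_card_commonLevels_le_card_add (Real.one_le_exp (by positivity)) hq M V u
  have hsq : ∀ ω, Z ω ^ 2 = ∑ u ∈ V, ∑ v ∈ V,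
      Real.exp (γ * levelField k M 1 (fun i => b i ω) u) *
      Real.exp (γ * levelField k M 1 (fun i => b i ω) v) := fun ω => by
    rw [sq, hZ, Finset.sum_mul_sum]
  simp only [← hsq] at h2i h2m
  have hdev : ∀ ω, (Z ω - m) ^ 2 = Z ω ^ 2 - 2 * m * Z ω + m ^ 2 := fun ω => by ring
  have hZi' : Integrable Z P := hZi
  have hi : Integrable (fun ω => (Z ω - m) ^ 2) P := by
    simp only [hdev]
    exact (h2i.sub (hZi'.const_mul _)).add (integrable_const _)
  have hint : ∫ ω, (Z ω - m) ^ 2 ∂P ≤ m ^ 2 * (16 * M * 4 ^ (k * M) / V.card) := by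
    have hexp : ∫ ω, (Z ω - m) ^ 2 ∂P = ∫ ω, Z ω ^ 2 ∂P - 2 * m * m + m ^ 2 := by
      have h1 : Integrable (fun ω => 2 * m * Z ω) P := hZi'.const_mul _
      have h2 : Integrable (fun ω => Z ω ^ 2 - 2 * m * Z ω) P := h2i.sub h1
      simp only [hdev]
      rw [integral_add h2 (integrable_const _), integral_sub h2i h1, integral_const_mul, hZm, ← hm]
      simp
    have hvar : Real.exp (γ ^ 2 * k * M) * (V.card * (V.card + 16 * M * 4 ^ (k * M))) =
        m ^ 2 + m ^ 2 * (16 * M * 4 ^ (k * M) / V.card) := by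
      rw [← hm2]
      field_simp
    linarith
  -- `Z < m / 2` forces a squared deviation of at least `m ^ 2 / 4`, which turns the 16 into 64.
  have h := mul_meas_ge_le_integral_of_nonneg (μ := P)
    (Eventually.of_forall fun ω => sq_nonneg (Z ω - m)) hi (m ^ 2 / 4)
  have hsub : P.real {ω | Z ω < m / 2} ≤ P.real {ω | m ^ 2 / 4 ≤ (Z ω - m) ^ 2} := by
    refine measureReal_mono fun ω hω => ?_
    have hω' : Z ω < m / 2 := hω
    simp only [Set.mem_ofPred_eq]
    nlinarith
  have h3 : m ^ 2 / 4 * P.real {ω | Z ω < m / 2} ≤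
      m ^ 2 / 4 * (64 * M * 4 ^ (k * M) / V.card) := by
    refine (mul_le_mul_of_nonneg_left hsub (by positivity)).trans (h.trans (hint.trans_eq ?_))
    ring
  exact le_of_mul_le_mul_left h3 (by positivity)

/-! ### Comparing full and truncated walks; the pair mass as a quotient. -/

theorem sq_sum_exp_le (V : Finset (ℤ × ℤ)) {f g h : ℤ × ℤ → ℝ} (hfg : ∀ z, g z + h z = 2 * f z) :
    (∑ z ∈ V, Real.exp (f z)) ^ 2 ≤ (∑ z ∈ V, Real.exp (g z)) * ∑ z ∈ V, Real.exp (h z) := by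
  refine Finset.sum_sq_le_sum_mul_sum_of_sq_le_mul V (fun z _ => Real.exp_nonneg _)
    (fun z _ => Real.exp_nonneg _) fun z _ => ?_
  rw [← Real.exp_add, hfg, ← Real.exp_nat_mul]
  norm_num

theorem levelField_add_levelField (k : ℕ) {M L : ℕ} (hML : M ≤ L) (x : ℕ × (ℤ × ℤ) → ℝ)
    (z : ℤ × ℤ) :
    levelField k L 1 x z + levelField k L (fun j => if j < M then 1 else -1) x z =
      2 * levelField k M 1 x z := by
  simp only [levelField, ← Finset.mul_sum, ← Finset.sum_add_distrib, ← add_mul]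
  rw [← Finset.sum_subset (Finset.range_mono hML), Finset.mul_sum]
  · refine Finset.sum_congr rfl fun j hj => ?_
    simp only [Finset.mem_range.mp hj, if_true, Pi.one_apply]
    ring
  · intro j _ hj
    simp only [Finset.mem_range.not.mp hj, if_false, Pi.one_apply]
    ring

theorem coarseMBRW_eq_levelField (k n : ℕ) (x : ℕ × (ℤ × ℤ) → ℝ) :
    coarseMBRW k n x = levelField k (n / k) 1 x := by
  funext z
  simp [coarseMBRW, levelField]

theorem lqgMeasure_prod_apply (γ : ℝ) (V : Finset (ℤ × ℤ)) (φ : ℤ × ℤ → ℝ)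
    (p : (ℤ × ℤ) × (ℤ × ℤ) → Prop) [DecidablePred p] :
    ((lqgMeasure γ V φ).prod (lqgMeasure γ V φ)) {x | p x} =
      ENNReal.ofReal ((∑ u ∈ V, ∑ v ∈ V with p (u, v), Real.exp (γ * φ u) * Real.exp (γ * φ v)) /
        (∑ w ∈ V, Real.exp (γ * φ w)) ^ 2) := by
  have hfin : IsFiniteMeasure (lqgMeasure γ V φ) := by
    constructor
    simp only [lqgMeasure, Measure.coe_finsetSum, Finset.sum_apply, Measure.smul_apply,
      measure_univ, smul_eq_mul, mul_one]
    exact ENNReal.sum_lt_top.mpr fun _ _ => ENNReal.ofReal_lt_top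
  set S := ∑ w ∈ V, Real.exp (γ * φ w) with hS
  have hS0 : 0 ≤ S := Finset.sum_nonneg fun _ _ => Real.exp_nonneg _
  have hsec : ∀ u : ℤ × ℤ, lqgMeasure γ V φ (Prod.mk u ⁻¹' {x | p x}) =
      ENNReal.ofReal (∑ v ∈ V with p (u, v), Real.exp (γ * φ v) / S) := by
    intro u
    rw [ENNReal.ofReal_sum_of_nonneg fun _ _ => by positivity, Finset.sum_filter]
    simp only [lqgMeasure, Measure.coe_finsetSum, Finset.sum_apply, Measure.smul_apply,
      smul_eq_mul]
    refine Finset.sum_congr rfl fun v _ => ?_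
    rw [Measure.dirac_apply' _ (Set.to_countable _).measurableSet]
    by_cases h : p (u, v) <;> simp [h, hS]
  rw [Measure.prod_apply (Set.to_countable _).measurableSet]
  simp only [hsec]
  conv_lhs => rw [lqgMeasure]
  rw [lintegral_finsetSum_measure]
  simp only [lintegral_smul_measure, lintegral_dirac, smul_eq_mul]
  rw [Finset.sum_div, ENNReal.ofReal_sum_of_nonneg fun _ _ =>
    div_nonneg (Finset.sum_nonneg fun _ _ => by positivity) (by positivity)]
  refine Finset.sum_congr rfl fun u _ => ?_
  rw [← ENNReal.ofReal_mul (by positivity), ← hS, ← Finset.sum_div, ← Finset.mul_sum]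
  congr 1
  rw [div_mul_div_comm, sq]

theorem card_latticeBox (n : ℕ) : (latticeBox (2 ^ n)).card = 4 ^ n := by
  have h : ((2 : ℤ) ^ n).toNat = 2 ^ n := by
    rw [← Nat.cast_ofNat, ← Nat.cast_pow, Int.toNat_natCast]
  simp [latticeBox, h, ← mul_pow]

/-! ### Combining the estimates. -/

/-- If the pair sum `S` and the auxiliary partition function `Y` are not too large and the
truncated partition function `X` is not too small, then `S / Z ^ 2` is small. -/
theorem div_sq_le_exp {c S X Y Z n τ A L M : ℝ} (hc : 0 < c) (hZ0 : 0 < Z)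
    (hS : S ≤ Real.exp (τ * n / 6) *
      (Real.exp (A * L) * (c * (16 * (L + 1) * (c * Real.exp (-(τ * n)))))))
    (hY : Y ≤ Real.exp (τ * n / 6) * (c * Real.exp (A * L / 2)))
    (hX : c * Real.exp (A * M / 2) / 2 ≤ X) (hXYZ : X ^ 2 ≤ Z * Y)
    (hn : 256 * (L + 1) ≤ Real.exp (τ * n / 8)) (hA : 2 * A * (L - M) ≤ τ * n / 8) :
    S / Z ^ 2 ≤ Real.exp (-(τ * n / 4)) := by
  have hZ : c / 4 * Real.exp (A * M - A * L / 2 - τ * n / 6) ≤ Z := by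
    have h1 : (c * Real.exp (A * M / 2) / 2) ^ 2 ≤
        Z * (Real.exp (τ * n / 6) * (c * Real.exp (A * L / 2))) :=
      (pow_le_pow_left₀ (by positivity) hX 2).trans
        (hXYZ.trans (mul_le_mul_of_nonneg_left hY hZ0.le))
    refine le_of_mul_le_mul_right (le_trans (le_of_eq ?_) h1)
      (by positivity : 0 < Real.exp (τ * n / 6) * (c * Real.exp (A * L / 2)))
    have h2 : Real.exp (A * M - A * L / 2 - τ * n / 6) *
        (Real.exp (τ * n / 6) * Real.exp (A * L / 2)) = Real.exp (A * M / 2) ^ 2 := by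
      rw [← Real.exp_add, ← Real.exp_add, sq, ← Real.exp_add]
      ring_nf
    linear_combination c ^ 2 / 4 * h2
  rw [div_le_iff₀ (by positivity)]
  have hZ2 := pow_le_pow_left₀ (by positivity) hZ 2
  refine hS.trans (le_trans ?_ (mul_le_mul_of_nonneg_left hZ2 (Real.exp_nonneg _)))
  -- Exponent budget in units of `τ n`: Markov costs 1/6 for `S` and 2/6 for `Z ^ 2`, the prefactor
  -- and the missing levels 1/8 each, leaving `1 - 1/2 - 1/4 = 1/4`. Here `256 = 16 * 4 ^ 2`.
  have h3 : 256 * (L + 1) ≤ Real.exp (τ * n / 4 - 2 * A * (L - M)) :=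
    hn.trans (Real.exp_le_exp.mpr (by linarith))
  have h4 : Real.exp (τ * n / 4 - 2 * A * (L - M)) *
      (Real.exp (τ * n / 6) * Real.exp (A * L) * Real.exp (-(τ * n))) =
      Real.exp (-(τ * n / 4)) * Real.exp (A * M - A * L / 2 - τ * n / 6) ^ 2 := by
    rw [sq, ← Real.exp_add, ← Real.exp_add, ← Real.exp_add, ← Real.exp_add, ← Real.exp_add]
    ring_nf
  have h5 := mul_le_mul_of_nonneg_right h3 (by positivity : 0 ≤
    c ^ 2 / 16 * (Real.exp (τ * n / 6) * Real.exp (A * L) * Real.exp (-(τ * n))))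
  linear_combination h5 + c ^ 2 / 16 * h4

theorem tendsto_sqrt_div {k : ℕ} (hk : 1 ≤ k) :
    Tendsto (fun n : ℕ => Nat.sqrt (n / k)) atTop atTop := by
  refine tendsto_atTop.mpr fun C => ?_
  filter_upwards [eventually_ge_atTop (C * C * k)] with n hn
  exact Nat.le_sqrt.mpr ((Nat.le_div_iff_mul_le hk).mpr hn)

theorem eventually_mul_add_one_le_exp {τ : ℝ} (hτ : 0 < τ) :
    ∀ᶠ n : ℕ in atTop, 256 * ((n : ℝ) + 1) ≤ Real.exp (τ * n / 8) := by
  filter_upwards [eventually_ge_atTop 1,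
    tendsto_natCast_atTop_atTop.eventually_ge_atTop (65536 / τ ^ 2)] with n hn1 hn2
  have h1 : (1 : ℝ) ≤ n := by exact_mod_cast hn1
  rw [div_le_iff₀ (by positivity)] at hn2
  have h0 : 0 ≤ τ * n / 8 := by positivity
  have := Real.quadratic_le_exp_of_nonneg h0
  nlinarith

/-- A quantitative estimate for the mass of pairs at distance at most `exp ((1 - κ) n log 2)`. -/
theorem IsBoxNoise.measureReal_pair_mass_le [IsProbabilityMeasure P] (hb : IsBoxNoise P b)
    {k : ℕ} (hk : 1 ≤ k) {γ κ : ℝ} (hγ : γ ^ 2 < 2 * Real.log 2) (hκ0 : 0 < κ) (hκ1 : κ ≤ 1)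
    {n : ℕ} (W : ℤ × ℤ → Finset (ℤ × ℤ))
    (hW : ∀ u, ∀ v ∈ W u, (linfDist u v : ℝ) < Real.exp ((1 - κ) * (n * Real.log 2)))
    {τ : ℝ} (hτ : τ = κ * (2 * Real.log 2 - γ ^ 2))
    (hn : 256 * ((n : ℝ) + 1) ≤ Real.exp (τ * n / 8))
    (hm : 16 * γ ^ 2 / τ ≤ Nat.sqrt (n / k)) :
    P.real {ω | Real.exp (-(τ * n / 4)) <
      (∑ u ∈ latticeBox (2 ^ n), ∑ v ∈ W u, Real.exp (γ * coarseMBRW k n (fun i => b i ω) u) *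
        Real.exp (γ * coarseMBRW k n (fun i => b i ω) v)) /
      (∑ w ∈ latticeBox (2 ^ n), Real.exp (γ * coarseMBRW k n (fun i => b i ω) w)) ^ 2} ≤
      2 * Real.exp (-(τ * n / 6)) + 256 * ((((Nat.sqrt (n / k) + 1 : ℕ) : ℝ)) ^ 2 /
        4 ^ (Nat.sqrt (n / k) + 1)) := by
  have hl : 0 < Real.log 2 := Real.log_pos one_lt_two
  have hτ0 : 0 < τ := by rw [hτ]; exact mul_pos hκ0 (by linarith)
  set V := latticeBox (2 ^ n) with hVdef
  set L := n / k with hLdef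
  -- `m → ∞` makes the Chebyshev error `4 ^ (-m)` beat the polynomial factor, while `k * m = o(n)`
  -- keeps the missing levels cheap.
  set m := Nat.sqrt L
  obtain ⟨M, hLM⟩ : ∃ M, L = m + M := Nat.exists_eq_add_of_le (Nat.sqrt_le_self L)
  have hML : M ≤ L := by omega
  have hkL : k * L ≤ n := Nat.mul_div_le n k
  have hkm : k * M + m ≤ n := by nlinarith
  have hVcard : (V.card : ℝ) = 4 ^ n := by rw [hVdef, card_latticeBox]; norm_num
  have hc0 : (0 : ℝ) < V.card := by rw [hVcard]; positivity
  have hVne : V.Nonempty := Finset.card_pos.mp (by exact_mod_cast hc0)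
  have hVexp : (V.card : ℝ) = Real.exp (n * (2 * Real.log 2)) := by
    rw [hVcard, Real.exp_nat_mul, two_mul, Real.exp_add, Real.exp_log two_pos]
    norm_num
  obtain ⟨s, hs0, hs1, hsγ⟩ : ∃ s : ℝ, 0 ≤ s ∧ s ≤ 1 ∧ γ ^ 2 = s * (2 * Real.log 2) :=
    ⟨γ ^ 2 / (2 * Real.log 2), by positivity, (div_le_one (by positivity)).mpr hγ.le,
      by field_simp⟩
  have hnl : 0 ≤ n * Real.log 2 := by positivity
  have hpair : ∀ u ∈ V, ∑ v ∈ W u, Real.exp (γ ^ 2 * k) ^ (commonLevels k L u v).card ≤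
      16 * ((L : ℝ) + 1) * (V.card * Real.exp (-(τ * n))) := by
    intro u _
    refine (sum_exp_pow_card_commonLevels_le hs0 hs1 hsγ hkL (mul_nonneg (by linarith) hnl)
      (mul_le_of_le_one_left hnl (by linarith)) (W u) u (hW u)).trans_eq ?_
    -- With `r = (1 - κ) n log 2`, the exponent `2 (1 - s) r + γ ^ 2 n` equals `2 n log 2 - τ n`.
    rw [hVexp, ← Real.exp_add, hτ, hsγ]
    ring_nf
  obtain ⟨hSi, hSm⟩ := hb.exp_sum_pairs hk L γ V W hpair
  set c : ℕ → ℝ := fun j => if j < M then 1 else -1 with hcdef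
  have hc2 : ∀ j, c j ^ 2 = 1 := fun j => by
    simp only [hcdef]
    split_ifs <;> norm_num
  obtain ⟨hYi, hYm⟩ := hb.exp_sum_levelField hk L c hc2 γ V
  set S : Ω → ℝ := fun ω => ∑ u ∈ V, ∑ v ∈ W u,
      Real.exp (γ * levelField k L 1 (fun i => b i ω) u) *
      Real.exp (γ * levelField k L 1 (fun i => b i ω) v) with hSdef
  set Y : Ω → ℝ := fun ω => ∑ z ∈ V, Real.exp (γ * levelField k L c (fun i => b i ω) z) with hYdef
  set X : Ω → ℝ := fun ω => ∑ z ∈ V, Real.exp (γ * levelField k M 1 (fun i => b i ω) z) with hXdef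
  set BS : ℝ := Real.exp (γ ^ 2 * k * L) *
    (V.card * (16 * ((L : ℝ) + 1) * (V.card * Real.exp (-(τ * n))))) with hBS
  set BY : ℝ := V.card * Real.exp (γ ^ 2 * k * L / 2) with hBY
  have hBS0 : 0 < BS := mul_pos (Real.exp_pos _) (mul_pos hc0 (mul_pos
    (mul_pos (by norm_num) (Nat.cast_add_one_pos L)) (mul_pos hc0 (Real.exp_pos _))))
  have hPS : P.real {ω | Real.exp (τ * n / 6) * BS < S ω} ≤ Real.exp (-(τ * n / 6)) :=
    measureReal_exp_mul_lt_le (fun ω => Finset.sum_nonneg fun u _ => Finset.sum_nonneg fun v _ =>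
      mul_nonneg (Real.exp_nonneg _) (Real.exp_nonneg _)) hSi hBS0 hSm _
  have hPY : P.real {ω | Real.exp (τ * n / 6) * BY < Y ω} ≤ Real.exp (-(τ * n / 6)) :=
    measureReal_exp_mul_lt_le (fun ω => Finset.sum_nonneg fun u _ => Real.exp_nonneg _) hYi
      (mul_pos hc0 (Real.exp_pos _)) hYm.le _
  have hPX : P.real {ω | X ω < V.card * Real.exp (γ ^ 2 * k * M / 2) / 2} ≤
      256 * (((m + 1 : ℕ) : ℝ) ^ 2 / 4 ^ (m + 1)) := by
    refine (hb.partition_lower_tail hk M hγ.le hVne).trans ?_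
    rw [hVcard]
    have hM : (M : ℝ) ≤ ((m + 1 : ℕ) : ℝ) ^ 2 := by
      have h1 : M ≤ (m + 1) ^ 2 := by
        have := Nat.lt_succ_sqrt' L
        exact hML.trans this.le
      exact_mod_cast h1
    have h4 : (4 : ℝ) ^ (k * M) * 4 ^ m ≤ 4 ^ n := by
      rw [← pow_add]
      exact pow_le_pow_right₀ (by norm_num) hkm
    rw [← mul_div_assoc, div_le_div_iff₀ (by positivity) (by positivity), pow_succ (4 : ℝ) m]
    have := mul_le_mul hM h4 (by positivity) (by positivity)
    linarith
  have hsub : {ω | Real.exp (-(τ * n / 4)) <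
      (∑ u ∈ V, ∑ v ∈ W u, Real.exp (γ * coarseMBRW k n (fun i => b i ω) u) *
        Real.exp (γ * coarseMBRW k n (fun i => b i ω) v)) /
      (∑ w ∈ V, Real.exp (γ * coarseMBRW k n (fun i => b i ω) w)) ^ 2} ⊆
      ({ω | Real.exp (τ * n / 6) * BS < S ω} ∪ {ω | Real.exp (τ * n / 6) * BY < Y ω}) ∪
        {ω | X ω < V.card * Real.exp (γ ^ 2 * k * M / 2) / 2} := by
    intro ω hω
    by_contra hcon
    simp only [Set.mem_union, Set.mem_ofPred_eq, not_or, not_lt] at hcon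
    obtain ⟨⟨h1, h2⟩, h3⟩ := hcon
    rw [Set.mem_ofPred_eq, ← not_le] at hω
    refine hω ?_
    simp only [coarseMBRW_eq_levelField]
    have hpos : ∀ f : ℤ × ℤ → ℝ, 0 < ∑ z ∈ V, Real.exp (f z) := fun f =>
      Finset.sum_pos (fun z _ => Real.exp_pos _) hVne
    refine div_sq_le_exp (A := γ ^ 2 * k) (L := L) (M := M) hc0 (hpos _) h1 h2 h3 ?_ ?_ ?_
    · refine sq_sum_exp_le V fun z => ?_
      linear_combination γ * levelField_add_levelField k hML (fun i => b i ω) z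
    · refine le_trans ?_ hn
      have : (L : ℝ) ≤ n := by exact_mod_cast Nat.div_le_self n k
      linarith
    · have h5 : (L : ℝ) - M = m := by rw [hLM]; push_cast; ring
      rw [h5]
      rw [div_le_iff₀ hτ0] at hm
      have h6 : (k : ℝ) * (m * m) ≤ n := by
        exact_mod_cast (Nat.mul_le_mul_left k (Nat.sqrt_le L)).trans hkL
      have h7 : (0 : ℝ) ≤ k * m := by positivity
      have h8 := mul_le_mul_of_nonneg_left hm h7
      have h9 := mul_le_mul_of_nonneg_left h6 hτ0.le
      linarith
  refine (measureReal_mono hsub).trans ((measureReal_union_le _ _).trans ?_)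
  linarith [measureReal_union_le (μ := P) {ω | Real.exp (τ * n / 6) * BS < S ω}
    {ω | Real.exp (τ * n / 6) * BY < Y ω}]

end CoarseMBRW

open CoarseMBRW in
theorem proposition3p1 (γ κ : ℝ) (hγ0 : 0 < γ) (hγ : γ < √(2 * Real.log 2)) (hκ : 0 < κ) :
    ∃ ρ : ℝ, 0 < ρ ∧
      ∀ (k : ℕ), 1 ≤ k →
      ∀ (Ω : Type*) [MeasurableSpace Ω] (P : Measure Ω) [IsProbabilityMeasure P]
        (b : ℕ × (ℤ × ℤ) → Ω → ℝ), CoarseMBRW.IsBoxNoise P b →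
        Tendsto
          (fun n : ℕ => P {ω |
            ENNReal.ofReal (((2 : ℝ) ^ n) ^ (-ρ)) <
              ((CoarseMBRW.lqgMeasure γ (CoarseMBRW.latticeBox (2 ^ n))
                  (CoarseMBRW.coarseMBRW k n fun i => b i ω)).prod
                (CoarseMBRW.lqgMeasure γ (CoarseMBRW.latticeBox (2 ^ n))
                  (CoarseMBRW.coarseMBRW k n fun i => b i ω)))
                {p : (ℤ × ℤ) × (ℤ × ℤ) |
                  (CoarseMBRW.linfDist p.1 p.2 : ℝ) < ((2 : ℝ) ^ n) ^ (1 - κ)}})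
          atTop (𝓝 0) := by
  classical
  have hl : 0 < Real.log 2 := Real.log_pos one_lt_two
  have hγ2 : γ ^ 2 < 2 * Real.log 2 := (Real.lt_sqrt hγ0.le).mp hγ
  -- Capping `κ` at 1 only enlarges the set of close pairs, and keeps the radius at least 1 for the
  -- counting bounds.
  obtain ⟨τ, hτ⟩ : ∃ τ, τ = min κ 1 * (2 * Real.log 2 - γ ^ 2) := ⟨_, rfl⟩
  have hκ0 : 0 < min κ 1 := lt_min hκ one_pos
  have hτ0 : 0 < τ := by rw [hτ]; exact mul_pos hκ0 (by linarith)
  have hpow : ∀ (n : ℕ) (y : ℝ), ((2 : ℝ) ^ n) ^ y = Real.exp (y * (n * Real.log 2)) := by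
    intro n y
    rw [Real.rpow_def_of_pos (by positivity), Real.log_pow, mul_comm]
  -- Chosen so that `N ^ (-ρ) = exp (-(τ n / 4))`.
  refine ⟨τ / (4 * Real.log 2), by positivity, fun k hk Ω _ P _ b hb => ?_⟩
  have hbound : Tendsto (fun n : ℕ => 2 * Real.exp (-(τ * n / 6)) +
      256 * ((((Nat.sqrt (n / k) + 1 : ℕ) : ℝ)) ^ 2 / 4 ^ (Nat.sqrt (n / k) + 1)))
      atTop (𝓝 0) := by
    have h1 : Tendsto (fun n : ℕ => Real.exp (-(τ * n / 6))) atTop (𝓝 0) :=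
      Real.tendsto_exp_neg_atTop_nhds_zero.comp
        ((tendsto_natCast_atTop_atTop.const_mul_atTop hτ0).atTop_div_const (by norm_num))
    have h2 := (tendsto_pow_const_div_const_pow_of_one_lt 2 (by norm_num : (1 : ℝ) < 4)).comp
      ((tendsto_add_atTop_nat 1).comp (tendsto_sqrt_div hk))
    simpa [Function.comp_def] using (h1.const_mul 2).add (h2.const_mul 256)
  have hbound' := ENNReal.tendsto_ofReal hbound
  rw [ENNReal.ofReal_zero] at hbound'
  refine tendsto_of_tendsto_of_tendsto_of_le_of_le' tendsto_const_nhds hbound'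
    (Eventually.of_forall fun _ => zero_le) ?_
  filter_upwards [eventually_mul_add_one_le_exp hτ0,
    (tendsto_natCast_atTop_atTop.comp (tendsto_sqrt_div hk)).eventually_ge_atTop
      (16 * γ ^ 2 / τ)] with n hn hm
  have h := hb.measureReal_pair_mass_le hk hγ2 hκ0 (min_le_right κ 1) (n := n)
    (fun u => {v ∈ latticeBox (2 ^ n) | (linfDist u v : ℝ) < ((2 : ℝ) ^ n) ^ (1 - κ)})
    (fun u v hv => (Finset.mem_filter.mp hv).2.trans_le ?_) hτ hn hm
  · rw [← ofReal_measureReal]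
    refine ENNReal.ofReal_le_ofReal (le_trans (measureReal_mono fun ω hω => ?_) h)
    have hω' := hω
    simp only [Set.mem_ofPred_eq] at hω' ⊢
    rw [lqgMeasure_prod_apply γ _ _ (fun p => (linfDist p.1 p.2 : ℝ) < ((2 : ℝ) ^ n) ^ (1 - κ)),
      hpow n (-(τ / (4 * Real.log 2)))] at hω'
    have he : -(τ / (4 * Real.log 2)) * (n * Real.log 2) = -(τ * n / 4) := by
      field_simp
    rw [he] at hω'
    exact (ENNReal.ofReal_lt_ofReal_iff_of_nonneg (Real.exp_nonneg _)).mp hω'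
  · rw [hpow]
    exact Real.exp_le_exp.mpr (mul_le_mul_of_nonneg_right
      (by linarith [min_le_left κ 1]) (by positivity))
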